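/- Let $\mathcal{BL}$ be the category of (real) Banach lattices, whose morphisms are the lattice homomorphisms, i.e. the bounded linear operators that commute with $\vee$, $\wedge$ and $|\cdot|$. A commutative square in $\mathcal{BL}$ formed by $\alpha_i\colon A_0\to A_i$ and $\beta_i\colon A_i\to P$ ($i=1,2$), $\beta_1\alpha_1=\beta_2\alpha_2$, is an *isometric push-out* if $\max\{\|\beta_1\|,\|\beta_2\|\}\le 1$ and, for every Banach lattice $B$ and all lattice homomorphisms $\beta_i'\colon A_i\to B$ ($i=1,2$) with $\beta_1'\alpha_1=\beta_2'\alpha_2$, there is a unique lattice homomorphism $\gamma\colon P\to B$ with $\gamma\beta_i=\beta_i'$ for $i=1,2$, and moreover $\|\gamma\|\le\max\{\|\beta_1'\|,\|\beta_2'\|\}$. For a Banach space $E$ with dual $E^*$, let $FBL[E]$ be the free Banach lattice generated by $E$, realized as follows. On the positively homogeneous functions $f\colon E^*\to\mathbb{R}$ put $$\|f\|=\sup\Big\{\sum_{k=1}^n|f(x_k^*)| : n\in\mathbb{N},\ x_1^*,\dots,x_n^*\in E^*,\ \sup_{\|x\|\le 1}\sum_{k=1}^n|x_k^*(x)|\le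 1\Big\}.$$ The functions with $\|f\|<\infty$ form a Banach lattice for the pointwise order, and $FBL[E]$ is its closed vector sublattice generated by the evaluations $\delta(x)\colon x^*\mapsto x^*(x)$, $x\in E$; the map $\delta\colon E\to FBL[E]$ is a linear isometric embedding. **Theorem.** Let $X_0,X_1,X_2$ be Banach lattices and let $T_i\colon X_0\to X_i$ ($i=1,2$) be lattice homomorphisms. Let $X_1\oplus_1X_2$ be the direct sum with the norm $\|(x_1,x_2)\|=\|x_1\|+\|x_2\|$ and let $j_i\colon X_i\to X_1\oplus_1X_2$ be the canonical embeddings. Let $Z$ be the closed ideal of $FBL[X_1\oplus_1X_2]$ generated by the elements $\delta(j_1|x|)-|\delta(j_1x)|$ ($x\in X_1$), $\delta(j_2|y|)-|\delta(j_2y)|$ ($y\in X_2$) and $\delta(j_1T_1z)-\delta(j_2T_2z)$ ($z\in X_0$). Let $PO=FBL[X_1\oplus_1X_2]/Z$, with the quotient norm and the quotient order, let $q\colon FBL[X_1\oplus_1X_2]\to PO$ be the quotient map, and let $S_i=q\circ\delta\circ j_i\colon X_i\to PO$ for $i=1,2$. Then: 1. $FBL[X_1\oplus_1X_2]$ with $\delta$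 is the free Banach lattice generated by $X_1\oplus_1X_2$: for every Banach lattice $X$ and every bounded operator $T\colon X_1\oplus_1X_2\to X$ there is a unique lattice homomorphism $\hat T\colon FBL[X_1\oplus_1X_2]\to X$ with $\hat T\circ\delta=T$, and moreover $\|\hat T\|=\|T\|$. 2. The square formed by $T_1,T_2,S_1,S_2$ is an isometric push-out in $\mathcal{BL}$. -/

import Mathlib

/-! ### Lattice homomorphisms

A (real) Banach lattice is a type `X` with the instances
`[NormedAddCommGroup X] [NormedSpace ℝ X] [CompleteSpace X] [Lattice X] [IsOrderedAddMonoid X]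
[IsOrderedModule ℝ X] [HasSolidNorm X]`. -/

/-- A bounded operator between Banach lattices that commutes with the lattice operations. -/
structure IsLatticeHom {X Y : Type*} [NormedAddCommGroup X] [NormedSpace ℝ X] [Lattice X]
    [NormedAddCommGroup Y] [NormedSpace ℝ Y] [Lattice Y] (T : X →L[ℝ] Y) : Prop where
  map_sup : ∀ x y, T (x ⊔ y) = T x ⊔ T y
  map_inf : ∀ x y, T (x ⊓ y) = T x ⊓ T y
  map_abs : ∀ x, T |x| = |T x|

/-! ### The free Banach lattice generated by a Banach space -/

section FreeBanachLattice

variable (E : Type*) [NormedAddCommGroup E] [NormedSpace ℝ E]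

/-- The sums `∑ |f (x_k*)|` over all finite families `x_1*, …, x_n*` in the dual of `E` such that
`∑ |x_k* (x)| ≤ 1` for all `x` in the unit ball, i.e. `∑ |x_k* (x)| ≤ ‖x‖` for all `x`. -/
def fblSums (f : StrongDual ℝ E → ℝ) : Set ℝ :=
  {s | ∃ (n : ℕ) (φ : Fin n → StrongDual ℝ E),
    (∀ x : E, ∑ k, |φ k x| ≤ ‖x‖) ∧ s = ∑ k, |f (φ k)|}

variable {E} in
theorem fblSums_nonempty (f : StrongDual ℝ E → ℝ) : (fblSums E f).Nonempty :=
  ⟨0, 0, Fin.elim0, by simp, by simp⟩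

variable {E} in
theorem fblSums_nonneg (f : StrongDual ℝ E → ℝ) {s : ℝ} (hs : s ∈ fblSums E f) : 0 ≤ s := by
  obtain ⟨n, φ, -, rfl⟩ := hs
  positivity

variable {E} in
theorem fblSums_bdd_of_le {f g h : StrongDual ℝ E → ℝ} (hf : BddAbove (fblSums E f))
    (hg : BddAbove (fblSums E g)) (c : ℝ) (hc : 0 ≤ c)
    (hh : ∀ φ, |h φ| ≤ c * |f φ| + |g φ|) : BddAbove (fblSums E h) := by
  obtain ⟨a, ha⟩ := hf
  obtain ⟨b, hb⟩ := hg
  refine ⟨c * a + b, ?_⟩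
  rintro s ⟨n, φ, hφ, rfl⟩
  calc ∑ k, |h (φ k)| ≤ ∑ k, (c * |f (φ k)| + |g (φ k)|) := Finset.sum_le_sum fun k _ => hh _
    _ = c * ∑ k, |f (φ k)| + ∑ k, |g (φ k)| := by
      rw [Finset.sum_add_distrib, Finset.mul_sum]
    _ ≤ c * a + b := by
      have h1 := ha ⟨n, φ, hφ, rfl⟩
      have h2 := hb ⟨n, φ, hφ, rfl⟩
      gcongr

/-- The positively homogeneous functions on the dual of `E` for which the free norm is finite. -/
def fblFunctions : Submodule ℝ (StrongDual ℝ E → ℝ) where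
  carrier := {f | (∀ (t : ℝ) (φ : StrongDual ℝ E), 0 ≤ t → f (t • φ) = t * f φ) ∧
    BddAbove (fblSums E f)}
  zero_mem' := by
    refine ⟨by simp, 0, ?_⟩
    rintro s ⟨n, φ, -, rfl⟩
    simp
  add_mem' := by
    rintro f g ⟨hf, hf'⟩ ⟨hg, hg'⟩
    refine ⟨fun t φ ht => by simp [hf t φ ht, hg t φ ht, mul_add], ?_⟩
    exact fblSums_bdd_of_le hf' hg' 1 zero_le_one fun φ => by simpa using abs_add_le _ _
  smul_mem' := by
    rintro c f ⟨hf, hf'⟩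
    refine ⟨fun t φ ht => by simp [hf t φ ht]; ring, ?_⟩
    refine fblSums_bdd_of_le hf' hf' |c| (abs_nonneg c) fun φ => ?_
    simp [abs_mul]

/-- The Banach lattice of all positively homogeneous functions `f` on the dual of `E` with
`‖f‖ = sup ∑ |f (x_k*)| < ∞`, ordered pointwise. -/
def FBLAmbient : Type _ := fblFunctions E

namespace FBLAmbient

variable {E}

instance : AddCommGroup (FBLAmbient E) := inferInstanceAs (AddCommGroup (fblFunctions E))

instance : Module ℝ (FBLAmbient E) := inferInstanceAs (Module ℝ (fblFunctions E))

instance : FunLike (FBLAmbient E) (StrongDual ℝ E) ℝ where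
  coe f := f.1
  coe_injective _ _ h := Subtype.ext h

/-- An element of the function lattice from the underlying function. -/
def ofFun (f : StrongDual ℝ E → ℝ) (h₁ : ∀ (t : ℝ) (φ : StrongDual ℝ E), 0 ≤ t → f (t • φ) = t * f φ)
    (h₂ : BddAbove (fblSums E f)) : FBLAmbient E := ⟨f, h₁, h₂⟩

@[simp] theorem ofFun_apply (f : StrongDual ℝ E → ℝ) (h₁ h₂) (φ : StrongDual ℝ E) :
    ofFun f h₁ h₂ φ = f φ := rfl

@[ext] theorem ext {f g : FBLAmbient E} (h : ∀ φ, f φ = g φ) : f = g := DFunLike.ext _ _ h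

theorem homog (f : FBLAmbient E) {t : ℝ} (ht : 0 ≤ t) (φ : StrongDual ℝ E) :
    f (t • φ) = t * f φ := f.2.1 t φ ht

theorem bdd (f : FBLAmbient E) : BddAbove (fblSums E f) := f.2.2

@[simp] theorem zero_apply (φ : StrongDual ℝ E) : (0 : FBLAmbient E) φ = 0 := rfl
@[simp] theorem add_apply (f g : FBLAmbient E) (φ : StrongDual ℝ E) : (f + g) φ = f φ + g φ := rfl
@[simp] theorem neg_apply (f : FBLAmbient E) (φ : StrongDual ℝ E) : (-f) φ = -f φ := rfl
@[simp] theorem sub_apply (f g : FBLAmbient E) (φ : StrongDual ℝ E) : (f - g) φ = f φ - g φ := rfl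
@[simp] theorem smul_apply (c : ℝ) (f : FBLAmbient E) (φ : StrongDual ℝ E) :
    (c • f) φ = c * f φ := rfl

noncomputable instance : Norm (FBLAmbient E) := ⟨fun f => sSup (fblSums E f)⟩

theorem norm_def (f : FBLAmbient E) : ‖f‖ = sSup (fblSums E f) := rfl

theorem sum_le_norm (f : FBLAmbient E) {n : ℕ} (φ : Fin n → StrongDual ℝ E)
    (hφ : ∀ x : E, ∑ k, |φ k x| ≤ ‖x‖) : ∑ k, |f (φ k)| ≤ ‖f‖ :=
  le_csSup f.bdd ⟨n, φ, hφ, rfl⟩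

theorem norm_le_of_sums {f : FBLAmbient E} {c : ℝ}
    (h : ∀ (n : ℕ) (φ : Fin n → StrongDual ℝ E), (∀ x : E, ∑ k, |φ k x| ≤ ‖x‖) →
      ∑ k, |f (φ k)| ≤ c) : ‖f‖ ≤ c := by
  refine csSup_le (fblSums_nonempty _) ?_
  rintro s ⟨n, φ, hφ, rfl⟩
  exact h n φ hφ

theorem norm_nonneg' (f : FBLAmbient E) : 0 ≤ ‖f‖ := by
  simpa using f.sum_le_norm (n := 0) Fin.elim0 (by simp)

theorem abs_apply_le (f : FBLAmbient E) (φ : StrongDual ℝ E) : |f φ| ≤ ‖f‖ * ‖φ‖ := by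
  rcases eq_or_ne φ 0 with rfl | hφ
  · have := f.homog le_rfl 0
    simp at this
    simp [this]
  · have hpos : 0 < ‖φ‖ := norm_pos_iff.2 hφ
    have h := f.sum_le_norm (n := 1) (fun _ => ‖φ‖⁻¹ • φ) (fun x => by
      have := φ.le_opNorm x
      rw [Real.norm_eq_abs] at this
      simp only [Finset.univ_unique, Finset.sum_singleton, _root_.smul_apply,
        smul_eq_mul, abs_mul, abs_inv, abs_norm]
      rw [inv_mul_le_iff₀ hpos]
      exact this)
    simp only [Finset.univ_unique, Finset.sum_singleton] at h
    rw [f.homog (by positivity), abs_mul, abs_inv, abs_norm, inv_mul_le_iff₀ hpos] at h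
    linarith [mul_comm ‖f‖ ‖φ‖]

theorem normCore : NormedSpace.Core ℝ (FBLAmbient E) where
  norm_nonneg := norm_nonneg'
  norm_smul c f := by
    have key : ∀ (c : ℝ) (f : FBLAmbient E), ‖c • f‖ ≤ |c| * ‖f‖ := fun c f => by
      refine norm_le_of_sums fun n φ hφ => ?_
      simp only [smul_apply, abs_mul, ← Finset.mul_sum]
      exact mul_le_mul_of_nonneg_left (f.sum_le_norm φ hφ) (abs_nonneg c)
    refine le_antisymm (key c f) ?_
    rcases eq_or_ne c 0 with rfl | hc
    · simpa using norm_nonneg' _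
    · have := key c⁻¹ (c • f)
      rw [smul_smul, inv_mul_cancel₀ hc, one_smul, abs_inv] at this
      rwa [Real.norm_eq_abs, ← le_inv_mul_iff₀ (abs_pos.2 hc)]
  norm_triangle f g := by
    refine norm_le_of_sums fun n φ hφ => ?_
    calc ∑ k, |(f + g) (φ k)| ≤ ∑ k, (|f (φ k)| + |g (φ k)|) :=
          Finset.sum_le_sum fun k _ => abs_add_le _ _
      _ = ∑ k, |f (φ k)| + ∑ k, |g (φ k)| := Finset.sum_add_distrib
      _ ≤ ‖f‖ + ‖g‖ := add_le_add (f.sum_le_norm φ hφ) (g.sum_le_norm φ hφ)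
  norm_eq_zero_iff f := by
    constructor
    · intro h
      ext φ
      have := f.abs_apply_le φ
      rw [h, zero_mul] at this
      simpa using this
    · rintro rfl
      refine le_antisymm (norm_le_of_sums fun n φ _ => by simp) (norm_nonneg' _)

noncomputable instance : NormedAddCommGroup (FBLAmbient E) := NormedAddCommGroup.ofCore normCore

noncomputable instance : NormedSpace ℝ (FBLAmbient E) := NormedSpace.ofCore normCore

instance : PartialOrder (FBLAmbient E) := inferInstanceAs (PartialOrder (fblFunctions E))

theorem le_def {f g : FBLAmbient E} : f ≤ g ↔ ∀ φ, f φ ≤ g φ := Iff.rfl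

noncomputable instance : Lattice (FBLAmbient E) where
  sup f g := ofFun (fun φ => f φ ⊔ g φ)
    (fun t φ ht => by
      simp only [f.homog ht, g.homog ht]
      exact (mul_max_of_nonneg _ _ ht).symm)
    (fblSums_bdd_of_le f.bdd g.bdd 1 zero_le_one fun φ => by
      rw [one_mul]
      exact abs_max_le_max_abs_abs.trans (max_le_add_of_nonneg (abs_nonneg _) (abs_nonneg _)))
  inf f g := ofFun (fun φ => f φ ⊓ g φ)
    (fun t φ ht => by
      simp only [f.homog ht, g.homog ht]
      exact (mul_min_of_nonneg _ _ ht).symm)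
    (fblSums_bdd_of_le f.bdd g.bdd 1 zero_le_one fun φ => by
      rw [one_mul]
      exact abs_min_le_max_abs_abs.trans (max_le_add_of_nonneg (abs_nonneg _) (abs_nonneg _)))
  le_sup_left f g φ := le_max_left _ _
  le_sup_right f g φ := le_max_right _ _
  sup_le f g h h1 h2 φ := max_le (h1 φ) (h2 φ)
  inf_le_left f g φ := min_le_left _ _
  inf_le_right f g φ := min_le_right _ _
  le_inf f g h h1 h2 φ := le_min (h1 φ) (h2 φ)

@[simp] theorem sup_apply (f g : FBLAmbient E) (φ : StrongDual ℝ E) : (f ⊔ g) φ = f φ ⊔ g φ := rfl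
@[simp] theorem inf_apply (f g : FBLAmbient E) (φ : StrongDual ℝ E) : (f ⊓ g) φ = f φ ⊓ g φ := rfl
@[simp] theorem abs_apply (f : FBLAmbient E) (φ : StrongDual ℝ E) : |f| φ = |f φ| := rfl

instance : IsOrderedAddMonoid (FBLAmbient E) where
  add_le_add_left _ _ h k φ := add_le_add_left (h φ) (k φ)

instance : IsOrderedModule ℝ (FBLAmbient E) where
  smul_le_smul_of_nonneg_left _ hc _ _ h φ := mul_le_mul_of_nonneg_left (h φ) hc
  smul_le_smul_of_nonneg_right _ hf _ _ h φ := mul_le_mul_of_nonneg_right h (hf φ)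

instance : HasSolidNorm (FBLAmbient E) where
  solid _ g h := norm_le_of_sums fun _ φ hφ =>
    (Finset.sum_le_sum fun k _ => h (φ k)).trans (g.sum_le_norm φ hφ)

instance : CompleteSpace (FBLAmbient E) := by
  refine Metric.complete_of_cauchySeq_tendsto fun u hu => ?_
  have hpt : ∀ φ, CauchySeq fun n => u n φ := fun φ => by
    rw [Metric.cauchySeq_iff] at hu ⊢
    intro ε hε
    obtain ⟨N, hN⟩ := hu (ε / (‖φ‖ + 1)) (by positivity)
    refine ⟨N, fun m hm n hn => ?_⟩
    have h1 := hN m hm n hn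
    rw [dist_eq_norm] at h1
    rw [lt_div_iff₀ (by positivity)] at h1
    rw [Real.dist_eq, ← sub_apply]
    have h2 := (u m - u n).abs_apply_le φ
    nlinarith [norm_nonneg (u m - u n), norm_nonneg φ]
  choose f hf using fun φ => cauchySeq_tendsto_of_complete (hpt φ)
  have key : ∀ ε > 0, ∃ N, ∀ m ≥ N, ∀ (n : ℕ) (φ : Fin n → StrongDual ℝ E),
      (∀ x : E, ∑ k, |φ k x| ≤ ‖x‖) → ∑ k, |u m (φ k) - f (φ k)| ≤ ε := by
    intro ε hε
    rw [Metric.cauchySeq_iff] at hu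
    obtain ⟨N, hN⟩ := hu ε hε
    refine ⟨N, fun m hm n φ hφ => ?_⟩
    have ht : Filter.Tendsto (fun j => ∑ k, |u m (φ k) - u j (φ k)|) Filter.atTop
        (nhds (∑ k, |u m (φ k) - f (φ k)|)) :=
      tendsto_finsetSum _ fun k _ => (tendsto_const_nhds.sub (hf (φ k))).abs
    refine le_of_tendsto ht (Filter.eventually_atTop.2 ⟨N, fun j hj => ?_⟩)
    have h1 := (u m - u j).sum_le_norm φ hφ
    have h2 := hN m hm j hj
    rw [dist_eq_norm] at h2
    exact h1.trans h2.le
  have hmem : f ∈ fblFunctions E := by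
    refine ⟨fun t φ ht => ?_, ?_⟩
    · refine tendsto_nhds_unique (hf (t • φ)) ?_
      simpa only [fun n => (u n).homog ht φ] using (hf φ).const_mul t
    · obtain ⟨N, hN⟩ := key 1 one_pos
      refine ⟨‖u N‖ + 1, ?_⟩
      rintro s ⟨n, φ, hφ, rfl⟩
      calc ∑ k, |f (φ k)| ≤ ∑ k, (|u N (φ k)| + |u N (φ k) - f (φ k)|) := by
            refine Finset.sum_le_sum fun k _ => ?_
            have := abs_sub (u N (φ k)) (u N (φ k) - f (φ k))
            simpa using this
        _ ≤ ‖u N‖ + 1 := by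
            rw [Finset.sum_add_distrib]
            exact add_le_add ((u N).sum_le_norm φ hφ) (hN N le_rfl n φ hφ)
  let F : FBLAmbient E := ⟨f, hmem⟩
  refine ⟨F, Metric.tendsto_atTop.2 fun ε hε => ?_⟩
  obtain ⟨N, hN⟩ := key (ε / 2) (by positivity)
  refine ⟨N, fun m hm => ?_⟩
  rw [dist_eq_norm]
  refine lt_of_le_of_lt (norm_le_of_sums (c := ε / 2) fun n φ hφ => hN m hm n φ hφ) (by linarith)

variable (E) in
/-- The evaluation functions `x* ↦ x* (x)`, as an isometric embedding of `E`. -/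
noncomputable def eval : E →ₗᵢ[ℝ] FBLAmbient E where
  toFun x := ofFun (fun φ => φ x) (fun t φ _ => by simp)
    ⟨‖x‖, by rintro s ⟨n, φ, hφ, rfl⟩; exact hφ x⟩
  map_add' x y := by ext φ; exact map_add φ x y
  map_smul' c x := by ext φ; exact map_smul φ c x
  norm_map' x := by
    refine le_antisymm (norm_le_of_sums fun n φ hφ => hφ x) ?_
    obtain ⟨g, hg, hgx⟩ := exists_dual_vector'' ℝ x
    refine le_csSup (FBLAmbient.bdd _) ⟨1, fun _ => g, fun y => ?_, ?_⟩
    · simpa using (g.le_opNorm y).trans (mul_le_of_le_one_left (norm_nonneg y) hg)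
    · rw [Finset.univ_unique, Finset.sum_singleton]
      exact (by rw [hgx]; exact (abs_norm x).symm : ‖x‖ = |g x|)

@[simp] theorem eval_apply (x : E) (φ : StrongDual ℝ E) : eval E x φ = φ x := rfl

end FBLAmbient

/-- The closed vector sublattice generated by a set: the smallest closed linear subspace that
contains the set and is stable under the lattice operations. -/
def closedSublatticeSpan {X : Type*} [NormedAddCommGroup X] [NormedSpace ℝ X] [Lattice X]
    (s : Set X) : Submodule ℝ X :=
  sInf {S : Submodule ℝ X | (∀ x ∈ S, ∀ y ∈ S, x ⊔ y ∈ S) ∧ (∀ x ∈ S, ∀ y ∈ S, x ⊓ y ∈ S) ∧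
    IsClosed (S : Set X) ∧ s ⊆ S}

section ClosedSublatticeSpan

variable {X : Type*} [NormedAddCommGroup X] [NormedSpace ℝ X] [Lattice X] {s : Set X}

theorem closedSublatticeSpan_sup {x y : X} (hx : x ∈ closedSublatticeSpan s)
    (hy : y ∈ closedSublatticeSpan s) : x ⊔ y ∈ closedSublatticeSpan s := by
  simp only [closedSublatticeSpan, Submodule.mem_sInf] at hx hy ⊢
  exact fun S hS => hS.1 x (hx S hS) y (hy S hS)

theorem closedSublatticeSpan_inf {x y : X} (hx : x ∈ closedSublatticeSpan s)
    (hy : y ∈ closedSublatticeSpan s) : x ⊓ y ∈ closedSublatticeSpan s := by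
  simp only [closedSublatticeSpan, Submodule.mem_sInf] at hx hy ⊢
  exact fun S hS => hS.2.1 x (hx S hS) y (hy S hS)

theorem isClosed_closedSublatticeSpan : IsClosed (closedSublatticeSpan s : Set X) := by
  simp only [closedSublatticeSpan, Submodule.coe_sInf]
  exact isClosed_biInter fun S hS => hS.2.2.1

theorem subset_closedSublatticeSpan : s ⊆ closedSublatticeSpan s := by
  intro x hx
  simp only [closedSublatticeSpan, SetLike.mem_coe, Submodule.mem_sInf]
  exact fun S hS => hS.2.2.2 hx

end ClosedSublatticeSpan

/-- The free Banach lattice generated by `E`: the closed vector sublattice generated by the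
evaluation functions. -/
def FBL : Type _ := closedSublatticeSpan (Set.range (FBLAmbient.eval E))

namespace FBL

variable {E}

noncomputable instance : NormedAddCommGroup (FBL E) :=
  inferInstanceAs (NormedAddCommGroup (closedSublatticeSpan (Set.range (FBLAmbient.eval E))))

noncomputable instance : NormedSpace ℝ (FBL E) :=
  inferInstanceAs (NormedSpace ℝ (closedSublatticeSpan (Set.range (FBLAmbient.eval E))))

instance : CompleteSpace (FBL E) :=
  (isClosed_closedSublatticeSpan (s := Set.range (FBLAmbient.eval E))).completeSpace_coe

/-- The order and the lattice operations are those of the ambient function lattice. -/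
noncomputable instance : Lattice (FBL E) :=
  Subtype.lattice (fun _ _ => closedSublatticeSpan_sup) (fun _ _ => closedSublatticeSpan_inf)

/-- The inclusion into the ambient function lattice. -/
def toAmbient (f : FBL E) : FBLAmbient E := f.1

theorem toAmbient_le {f g : FBL E} : f ≤ g ↔ f.toAmbient ≤ g.toAmbient := Iff.rfl

theorem toAmbient_add (f g : FBL E) : (f + g).toAmbient = f.toAmbient + g.toAmbient := rfl

theorem toAmbient_smul (c : ℝ) (f : FBL E) : (c • f).toAmbient = c • f.toAmbient := rfl

theorem toAmbient_sup (f g : FBL E) : (f ⊔ g).toAmbient = f.toAmbient ⊔ g.toAmbient := rfl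

theorem toAmbient_inf (f g : FBL E) : (f ⊓ g).toAmbient = f.toAmbient ⊓ g.toAmbient := rfl

theorem toAmbient_abs (f : FBL E) : |f|.toAmbient = |f.toAmbient| := rfl

theorem norm_toAmbient (f : FBL E) : ‖f.toAmbient‖ = ‖f‖ := rfl

instance : IsOrderedAddMonoid (FBL E) where
  add_le_add_left f g h k := by
    rw [toAmbient_le, toAmbient_add, toAmbient_add]
    exact add_le_add_left (toAmbient_le.1 h) _

instance : IsOrderedModule ℝ (FBL E) where
  smul_le_smul_of_nonneg_left c hc f g h := by
    have h' := toAmbient_le.1 h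
    simp only [toAmbient_le, toAmbient_smul]
    exact smul_le_smul_of_nonneg_left h' hc
  smul_le_smul_of_nonneg_right f hf c d h := by
    have h' : 0 ≤ f.toAmbient := hf
    simp only [toAmbient_le, toAmbient_smul]
    exact smul_le_smul_of_nonneg_right h h'

instance : HasSolidNorm (FBL E) where
  solid f g h := by
    have h' := toAmbient_le.1 h
    rw [toAmbient_abs, toAmbient_abs] at h'
    rw [← norm_toAmbient, ← norm_toAmbient g]
    exact norm_le_norm_of_abs_le_abs h'

variable (E) in
/-- The canonical isometric embedding of `E` into the free Banach lattice that it generates. -/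
noncomputable def delta : E →ₗᵢ[ℝ] FBL E where
  toFun x := ⟨FBLAmbient.eval E x, subset_closedSublatticeSpan ⟨x, rfl⟩⟩
  map_add' x y := Subtype.ext (map_add (FBLAmbient.eval E) x y)
  map_smul' c x := Subtype.ext (map_smul (FBLAmbient.eval E) c x)
  norm_map' x := (FBLAmbient.eval E).norm_map x

end FBL

end FreeBanachLattice

/-- The universal property of the free Banach lattice generated by `E`, tested on the Banach
lattices in the universe `w`: every bounded operator `T` from `E` into a Banach lattice factors
through `δ` by a unique lattice homomorphism, and this one has the norm of `T`. -/
def IsFreeBanachLattice.{w, u, v} {E : Type u} [NormedAddCommGroup E] [NormedSpace ℝ E]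
    [CompleteSpace E] {F : Type v} [NormedAddCommGroup F] [NormedSpace ℝ F] [CompleteSpace F] [Lattice F]
    [IsOrderedAddMonoid F] [IsOrderedModule ℝ F] [HasSolidNorm F]
    (δ : E →ₗᵢ[ℝ] F) : Prop :=
  ∀ (X : Type w) [NormedAddCommGroup X] [NormedSpace ℝ X] [CompleteSpace X] [Lattice X]
    [IsOrderedAddMonoid X] [IsOrderedModule ℝ X] [HasSolidNorm X] (T : E →L[ℝ] X),
    ∃ U : F →L[ℝ] X, IsLatticeHom U ∧ U ∘L δ.toContinuousLinearMap = T ∧ ‖U‖ = ‖T‖ ∧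
      ∀ V : F →L[ℝ] X, IsLatticeHom V → V ∘L δ.toContinuousLinearMap = T → V = U

/-! ### Closed ideals and quotients of Banach lattices -/

/-- A closed ideal of a Banach lattice: a closed solid linear subspace. -/
structure ClosedIdeal (F : Type*) [NormedAddCommGroup F] [NormedSpace ℝ F] [Lattice F] where
  toSubmodule : Submodule ℝ F
  isSolid : LatticeOrderedAddCommGroup.IsSolid (toSubmodule : Set F)
  isClosed : IsClosed (toSubmodule : Set F)

namespace ClosedIdeal

section Defs

variable {F : Type*} [NormedAddCommGroup F] [NormedSpace ℝ F] [Lattice F]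

/-- The closed ideal generated by a set: the intersection of all closed ideals containing it. -/
def span (s : Set F) : ClosedIdeal F where
  toSubmodule := ⨅ I : {I : ClosedIdeal F // s ⊆ I.toSubmodule}, I.1.toSubmodule
  isSolid x hx y hxy := by
    simp only [SetLike.mem_coe, Submodule.mem_iInf] at hx ⊢
    exact fun I => I.1.isSolid (hx I) hxy
  isClosed := by
    simp only [Submodule.coe_iInf]
    exact isClosed_iInter fun I => I.1.isClosed

/-- The quotient of a Banach lattice by a closed ideal. -/
def Quot (I : ClosedIdeal F) : Type _ := F ⧸ I.toSubmodule

/-- The norm is the quotient norm. -/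
noncomputable instance (I : ClosedIdeal F) : NormedAddCommGroup I.Quot :=
  haveI := I.isClosed
  inferInstanceAs (NormedAddCommGroup (F ⧸ I.toSubmodule))

noncomputable instance (I : ClosedIdeal F) : NormedSpace ℝ I.Quot :=
  inferInstanceAs (NormedSpace ℝ (F ⧸ I.toSubmodule))

instance (I : ClosedIdeal F) [CompleteSpace F] : CompleteSpace I.Quot :=
  inferInstanceAs (CompleteSpace (F ⧸ I.toSubmodule))

/-- The canonical quotient map. -/
def mkQ (I : ClosedIdeal F) : F →L[ℝ] I.Quot := I.toSubmodule.mkQL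

theorem mk_surjective (I : ClosedIdeal F) : Function.Surjective I.mkQ :=
  Submodule.mkQ_surjective _

theorem mk_eq_mk (I : ClosedIdeal F) {a b : F} : I.mkQ a = I.mkQ b ↔ a - b ∈ I.toSubmodule :=
  Submodule.Quotient.eq _

theorem norm_mk_le (I : ClosedIdeal F) (a : F) : ‖I.mkQ a‖ ≤ ‖a‖ :=
  Submodule.Quotient.norm_mk_le _ a

theorem exists_mk_eq_norm_lt (I : ClosedIdeal F) (x : I.Quot) {ε : ℝ} (hε : 0 < ε) :
    ∃ a, I.mkQ a = x ∧ ‖a‖ < ‖x‖ + ε :=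
  Submodule.Quotient.norm_mk_lt (S := I.toSubmodule) x hε

end Defs

variable {F : Type*} [NormedAddCommGroup F] [NormedSpace ℝ F] [Lattice F] [IsOrderedAddMonoid F]
  (I : ClosedIdeal F)

theorem mk_sup_congr {a a' b b' : F} (ha : I.mkQ a = I.mkQ a') (hb : I.mkQ b = I.mkQ b') :
    I.mkQ (a ⊔ b) = I.mkQ (a' ⊔ b') := by
  have key : ∀ x y z : F, I.mkQ x = I.mkQ y → I.mkQ (x ⊔ z) = I.mkQ (y ⊔ z) := fun x y z h => by
    rw [mk_eq_mk] at h ⊢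
    exact I.isSolid h (abs_sup_sub_sup_le_abs x y z)
  rw [key a a' b ha, sup_comm, key b b' a' hb, sup_comm]

theorem mk_inf_congr {a a' b b' : F} (ha : I.mkQ a = I.mkQ a') (hb : I.mkQ b = I.mkQ b') :
    I.mkQ (a ⊓ b) = I.mkQ (a' ⊓ b') := by
  have key : ∀ x y z : F, I.mkQ x = I.mkQ y → I.mkQ (x ⊓ z) = I.mkQ (y ⊓ z) := fun x y z h => by
    rw [mk_eq_mk] at h ⊢
    exact I.isSolid h (abs_inf_sub_inf_le_abs x y z)
  rw [key a a' b ha, inf_comm, key b b' a' hb, inf_comm]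

/-- The quotient order: the order relation induced by the order of representatives. -/
instance : LE I.Quot := ⟨fun x y => ∃ a b, I.mkQ a = x ∧ I.mkQ b = y ∧ a ≤ b⟩

theorem mk_le_mk {a b : F} : I.mkQ a ≤ I.mkQ b ↔ I.mkQ (a ⊔ b) = I.mkQ b := by
  constructor
  · rintro ⟨a', b', ha, hb, hab⟩
    rw [← I.mk_sup_congr ha hb, sup_eq_right.2 hab, hb]
  · intro h
    exact ⟨a, a ⊔ b, rfl, h, le_sup_left⟩

instance : PartialOrder I.Quot where
  le_refl x := by
    obtain ⟨a, rfl⟩ := I.mk_surjective x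
    exact ⟨a, a, rfl, rfl, le_rfl⟩
  le_trans x y z hxy hyz := by
    obtain ⟨a, rfl⟩ := I.mk_surjective x
    obtain ⟨b, rfl⟩ := I.mk_surjective y
    obtain ⟨c, rfl⟩ := I.mk_surjective z
    rw [mk_le_mk] at *
    rw [← I.mk_sup_congr (rfl : I.mkQ a = I.mkQ a) hyz, ← sup_assoc,
      I.mk_sup_congr hxy (rfl : I.mkQ c = I.mkQ c), hyz]
  le_antisymm x y hxy hyx := by
    obtain ⟨a, rfl⟩ := I.mk_surjective x
    obtain ⟨b, rfl⟩ := I.mk_surjective y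
    rw [mk_le_mk] at *
    rw [← hxy, sup_comm, hyx]

/-- The lattice operations satisfy `mkQ (a ⊔ b) = mkQ a ⊔ mkQ b` and `mkQ (a ⊓ b) = mkQ a ⊓ mkQ b`. -/
noncomputable instance : Lattice I.Quot where
  sup x y := I.mkQ (Function.surjInv I.mk_surjective x ⊔ Function.surjInv I.mk_surjective y)
  inf x y := I.mkQ (Function.surjInv I.mk_surjective x ⊓ Function.surjInv I.mk_surjective y)
  le_sup_left x y :=
    ⟨_, _, Function.surjInv_eq I.mk_surjective x, rfl, le_sup_left⟩
  le_sup_right x y :=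
    ⟨_, _, Function.surjInv_eq I.mk_surjective y, rfl, le_sup_right⟩
  sup_le x y z hx hy := by
    obtain ⟨c, rfl⟩ := I.mk_surjective z
    rw [← Function.surjInv_eq I.mk_surjective x, mk_le_mk] at hx
    rw [← Function.surjInv_eq I.mk_surjective y, mk_le_mk] at hy
    rw [mk_le_mk, sup_assoc, I.mk_sup_congr rfl hy, hx]
  inf_le_left x y :=
    ⟨_, _, rfl, Function.surjInv_eq I.mk_surjective x, inf_le_left⟩
  inf_le_right x y :=
    ⟨_, _, rfl, Function.surjInv_eq I.mk_surjective y, inf_le_right⟩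
  le_inf x y z hy hz := by
    obtain ⟨a, rfl⟩ := I.mk_surjective x
    rw [← Function.surjInv_eq I.mk_surjective y, mk_le_mk] at hy
    rw [← Function.surjInv_eq I.mk_surjective z, mk_le_mk] at hz
    exact ⟨a ⊓ ((a ⊔ Function.surjInv I.mk_surjective y) ⊓
      (a ⊔ Function.surjInv I.mk_surjective z)), _, by simp, I.mk_inf_congr hy hz, inf_le_right⟩

theorem mk_sup (a b : F) : I.mkQ (a ⊔ b) = I.mkQ a ⊔ I.mkQ b :=
  I.mk_sup_congr (Function.surjInv_eq I.mk_surjective _).symm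
    (Function.surjInv_eq I.mk_surjective _).symm

theorem mk_inf (a b : F) : I.mkQ (a ⊓ b) = I.mkQ a ⊓ I.mkQ b :=
  I.mk_inf_congr (Function.surjInv_eq I.mk_surjective _).symm
    (Function.surjInv_eq I.mk_surjective _).symm

theorem mk_abs (a : F) : I.mkQ |a| = |I.mkQ a| := by
  rw [abs, mk_sup, map_neg, abs]

instance : IsOrderedAddMonoid I.Quot where
  add_le_add_left x y h z := by
    obtain ⟨a, b, rfl, rfl, hab⟩ := h
    obtain ⟨c, rfl⟩ := I.mk_surjective z
    exact ⟨a + c, b + c, map_add _ _ _, map_add _ _ _, add_le_add_left hab c⟩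

instance [IsOrderedModule ℝ F] : IsOrderedModule ℝ I.Quot where
  smul_le_smul_of_nonneg_left c hc x y h := by
    obtain ⟨a, b, rfl, rfl, hab⟩ := h
    exact ⟨c • a, c • b, map_smul _ _ _, map_smul _ _ _, smul_le_smul_of_nonneg_left hab hc⟩
  smul_le_smul_of_nonneg_right x hx c d h := by
    obtain ⟨a, rfl⟩ := I.mk_surjective x
    have h0 : I.mkQ |a| = I.mkQ a := by rw [mk_abs, abs_of_nonneg hx]
    exact ⟨c • |a|, d • |a|, by rw [map_smul, h0], by rw [map_smul, h0],
      smul_le_smul_of_nonneg_right h (abs_nonneg a)⟩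

instance [HasSolidNorm F] : HasSolidNorm I.Quot where
  solid x y h := by
    refine le_of_forall_pos_le_add fun ε hε => ?_
    obtain ⟨c, rfl, hc⟩ := I.exists_mk_eq_norm_lt y hε
    obtain ⟨a, rfl⟩ := I.mk_surjective x
    have h1 : I.mkQ ((a ⊓ |c|) ⊔ -|c|) = I.mkQ a := by
      rw [mk_sup, mk_inf, map_neg, mk_abs, inf_eq_left.2 ((le_abs_self _).trans h),
        sup_eq_left.2 (neg_le.1 ((neg_le_abs _).trans h))]
    have h2 : |(a ⊓ |c|) ⊔ (-|c|)| ≤ |c| := by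
      refine abs_le'.2 ⟨sup_le inf_le_right ?_, neg_le.1 le_sup_right⟩
      exact (neg_nonpos.2 (abs_nonneg c)).trans (abs_nonneg c)
    calc ‖I.mkQ a‖ = ‖I.mkQ ((a ⊓ |c|) ⊔ -|c|)‖ := by rw [h1]
      _ ≤ ‖(a ⊓ |c|) ⊔ -|c|‖ := I.norm_mk_le _
      _ ≤ ‖c‖ := norm_le_norm_of_abs_le_abs h2
      _ ≤ _ := hc.le

end ClosedIdeal

/-! ### Isometric push-outs -/

/-- The square formed by `α₁, α₂, β₁, β₂` is an isometric push-out in the category of Banach lattices and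
lattice homomorphisms, tested on the Banach lattices in the universe `w`. -/
structure IsIsometricPushout.{w, u₀, u₁, u₂, v}
    {A₀ : Type u₀} [NormedAddCommGroup A₀] [NormedSpace ℝ A₀] [CompleteSpace A₀] [Lattice A₀]
    [IsOrderedAddMonoid A₀] [IsOrderedModule ℝ A₀] [HasSolidNorm A₀]
    {A₁ : Type u₁} [NormedAddCommGroup A₁] [NormedSpace ℝ A₁] [CompleteSpace A₁] [Lattice A₁]
    [IsOrderedAddMonoid A₁] [IsOrderedModule ℝ A₁] [HasSolidNorm A₁]
    {A₂ : Type u₂} [NormedAddCommGroup A₂] [NormedSpace ℝ A₂] [CompleteSpace A₂] [Lattice A₂]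
    [IsOrderedAddMonoid A₂] [IsOrderedModule ℝ A₂] [HasSolidNorm A₂]
    {P : Type v} [NormedAddCommGroup P] [NormedSpace ℝ P] [CompleteSpace P] [Lattice P]
    [IsOrderedAddMonoid P] [IsOrderedModule ℝ P] [HasSolidNorm P]
    (α₁ : A₀ →L[ℝ] A₁) (α₂ : A₀ →L[ℝ] A₂) (β₁ : A₁ →L[ℝ] P) (β₂ : A₂ →L[ℝ] P) : Prop where
  isLatticeHom_left : IsLatticeHom β₁
  isLatticeHom_right : IsLatticeHom β₂
  comm : β₁ ∘L α₁ = β₂ ∘L α₂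
  norm_le_one : max ‖β₁‖ ‖β₂‖ ≤ 1
  universal : ∀ (B : Type w) [NormedAddCommGroup B] [NormedSpace ℝ B] [CompleteSpace B] [Lattice B]
    [IsOrderedAddMonoid B] [IsOrderedModule ℝ B] [HasSolidNorm B]
    (β₁' : A₁ →L[ℝ] B) (β₂' : A₂ →L[ℝ] B), IsLatticeHom β₁' → IsLatticeHom β₂' →
    β₁' ∘L α₁ = β₂' ∘L α₂ →
    ∃ γ : P →L[ℝ] B, IsLatticeHom γ ∧ γ ∘L β₁ = β₁' ∧ γ ∘L β₂ = β₂' ∧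
      ‖γ‖ ≤ max ‖β₁'‖ ‖β₂'‖ ∧
      ∀ γ' : P →L[ℝ] B, IsLatticeHom γ' → γ' ∘L β₁ = β₁' → γ' ∘L β₂ = β₂' → γ' = γ

/-! ### The push-out construction -/

section PushOut

/-- The direct sum `X₁ ⊕₁ X₂` with the norm `‖(x₁, x₂)‖ = ‖x₁‖ + ‖x₂‖`. -/
abbrev L1Sum (X₁ X₂ : Type*) : Type _ := WithLp 1 (X₁ × X₂)

variable {X₀ X₁ X₂ : Type*} [NormedAddCommGroup X₀] [NormedSpace ℝ X₀]
  [NormedAddCommGroup X₁] [NormedSpace ℝ X₁] [NormedAddCommGroup X₂] [NormedSpace ℝ X₂]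

variable (X₁ X₂) in
/-- The canonical embedding `x ↦ (x, 0)` of `X₁` into `X₁ ⊕₁ X₂`. -/
noncomputable def L1Sum.inl : X₁ →L[ℝ] L1Sum X₁ X₂ :=
  ((WithLp.prodContinuousLinearEquiv 1 ℝ X₁ X₂).symm : X₁ × X₂ →L[ℝ] L1Sum X₁ X₂) ∘L
    ContinuousLinearMap.inl ℝ X₁ X₂

variable (X₁ X₂) in
/-- The canonical embedding `y ↦ (0, y)` of `X₂` into `X₁ ⊕₁ X₂`. -/
noncomputable def L1Sum.inr : X₂ →L[ℝ] L1Sum X₁ X₂ :=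
  ((WithLp.prodContinuousLinearEquiv 1 ℝ X₁ X₂).symm : X₁ × X₂ →L[ℝ] L1Sum X₁ X₂) ∘L
    ContinuousLinearMap.inr ℝ X₁ X₂

variable [Lattice X₁] [Lattice X₂] (T₁ : X₀ →L[ℝ] X₁) (T₂ : X₀ →L[ℝ] X₂)

open FBL L1Sum in
/-- The closed ideal of `FBL[X₁ ⊕₁ X₂]` generated by the elements `δ (j₁ |x|) - |δ (j₁ x)|`,
`δ (j₂ |y|) - |δ (j₂ y)|` and `δ (j₁ (T₁ z)) - δ (j₂ (T₂ z))`. -/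
noncomputable def pushOutIdeal : ClosedIdeal (FBL (L1Sum X₁ X₂)) :=
  ClosedIdeal.span
    (Set.range (fun x : X₁ => delta _ (inl X₁ X₂ |x|) - |delta _ (inl X₁ X₂ x)|) ∪
     Set.range (fun y : X₂ => delta _ (inr X₁ X₂ |y|) - |delta _ (inr X₁ X₂ y)|) ∪
     Set.range (fun z : X₀ => delta _ (inl X₁ X₂ (T₁ z)) - delta _ (inr X₁ X₂ (T₂ z))))

/-- The Banach lattice `PO = FBL[X₁ ⊕₁ X₂] / Z`. -/
abbrev PushOut : Type _ := (pushOutIdeal T₁ T₂).Quot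

/-- The map `S₁ = q ∘ δ ∘ j₁`. -/
noncomputable def PushOut.inl : X₁ →L[ℝ] PushOut T₁ T₂ :=
  (pushOutIdeal T₁ T₂).mkQ ∘L (FBL.delta (L1Sum X₁ X₂)).toContinuousLinearMap ∘L L1Sum.inl X₁ X₂

/-- The map `S₂ = q ∘ δ ∘ j₂`. -/
noncomputable def PushOut.inr : X₂ →L[ℝ] PushOut T₁ T₂ :=
  (pushOutIdeal T₁ T₂).mkQ ∘L (FBL.delta (L1Sum X₁ X₂)).toContinuousLinearMap ∘L L1Sum.inr X₁ X₂

end PushOut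

universe w u₀ u₁ u₂

/-! ### Banach lattice preliminaries -/

section Preliminaries

variable {X : Type*} [AddCommGroup X] [Lattice X]

/-! The substance is the extension of a bounded `T : E → X` to `FBL E` without increase of norm. If
a functional `p` on `X` were a lattice homomorphism, a lattice expression `u` in vectors `T x` would
satisfy `p u = f (p ∘ T)`, where `f` is the same expression in the evaluations. A Banach lattice may
have too few such functionals, but only finitely many comparisons enter each expression. By
Hahn–Banach a positive functional splits along any `w` into positive parts vanishing on `w⁻` and on
`w⁺` (`IsPosFunctional.exists_split`). Repeated splitting writes it as a finite sum of pieces for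
which the identity holds, and holds for everything below them: the pair `(f, u)` is exact
(`IsExactPair.sup`).

For an exact pair choose a positive `p` with `‖p‖ ≤ 1` and `p |u| = ‖u‖`, and split it into pieces
`pᵢ` exact for `(|f|, |u|)`. Then `‖u‖ = ∑ |f (pᵢ ∘ T)|`, while `∑ |pᵢ (T x)| ≤ p |T x| ≤ ‖T‖ ‖x‖`,
so the definition of the free norm gives `‖u‖ ≤ ‖T‖ ‖f‖` (`IsExactPair.norm_le`). Hence the closure
of the exact pairs is, over `FBL E`, the graph of the required extension; uniqueness holds because
the evaluations generate.

The push-out is then formal: `X₁ ⊕₁ X₂` is the isometric coproduct of Banach spaces, `FBL` turns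
bounded operators out of it into lattice homomorphisms with the same norm, and the quotient by `Z`
imposes exactly the relations of a commutative square of lattice homomorphisms. -/

theorem posPart_add_le_add [IsOrderedAddMonoid X] (x y : X) : (x + y)⁺ ≤ x⁺ + y⁺ :=
  sup_le (add_le_add (le_posPart x) (le_posPart y)) (add_nonneg (posPart_nonneg x) (posPart_nonneg y))

theorem posPart_smul_of_pos [Module ℝ X] [IsOrderedModule ℝ X] {c : ℝ} (hc : 0 < c) (x : X) :
    (c • x)⁺ = c • x⁺ := by
  have h : c • (x ⊔ 0) = c • x ⊔ c • 0 := (OrderIso.smulRight (β := X) hc).map_sup x 0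
  rw [posPart_def, posPart_def, h, smul_zero]

end Preliminaries

/-- A nonnegative sublinear functional dominates a linear functional with which it agrees at a
given vector. -/
theorem exists_linear_le_sublinear_eq {V : Type*} [AddCommGroup V] [Module ℝ V] (N : V → ℝ)
    (hsmul : ∀ c : ℝ, 0 < c → ∀ x, N (c • x) = c * N x) (hadd : ∀ x y, N (x + y) ≤ N x + N y)
    (hnonneg : ∀ x, 0 ≤ N x) (w : V) : ∃ g : V →ₗ[ℝ] ℝ, g w = N w ∧ ∀ x, g x ≤ N x := by
  have h0 : N 0 = 0 := by
    have := hsmul 2 two_pos 0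
    rw [smul_zero] at this
    linarith
  rcases eq_or_ne w 0 with rfl | hw
  · exact ⟨0, by simp [h0], fun x => by simpa using hnonneg x⟩
  obtain ⟨g, hg, hle⟩ := exists_extension_of_le_sublinear
    (LinearPMap.mkSpanSingleton (K := ℝ) w (N w) hw) N hsmul hadd (by
      rintro ⟨x, hx⟩
      obtain ⟨c, rfl⟩ := Submodule.mem_span_singleton.1 hx
      rw [LinearPMap.mkSpanSingleton'_apply, RingHom.id_apply, smul_eq_mul]
      rcases lt_trichotomy c 0 with hc | rfl | hc
      -- Nonnegativity of `N` settles negative multiples of `w`: `c * N w ≤ 0 ≤ N (c • w)`.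
      · exact (mul_nonpos_of_nonpos_of_nonneg hc.le (hnonneg w)).trans (hnonneg _)
      · simpa using hnonneg _
      · exact (hsmul c hc w).ge)
  refine ⟨g, ?_, hle⟩
  exact (hg ⟨w, Submodule.mem_span_singleton_self w⟩).trans
    (LinearPMap.mkSpanSingleton_apply ℝ ℝ hw (N w))

/-! ### Positive functionals: norming and splitting. -/

section PositiveFunctionals

variable {X : Type*} [NormedAddCommGroup X] [NormedSpace ℝ X] [Lattice X]

/-- Positivity of a bounded functional on an ordered normed space. -/
def IsPosFunctional (p : StrongDual ℝ X) : Prop := ∀ x, 0 ≤ x → 0 ≤ p x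

namespace IsPosFunctional

variable {p p' : StrongDual ℝ X}

theorem zero : IsPosFunctional (0 : StrongDual ℝ X) := fun _ _ => le_rfl

theorem add (h : IsPosFunctional p) (h' : IsPosFunctional p') : IsPosFunctional (p + p') :=
  fun x hx => add_nonneg (h x hx) (h' x hx)

variable [IsOrderedAddMonoid X]

theorem mono (h : IsPosFunctional p) {x y : X} (hxy : x ≤ y) : p x ≤ p y := by
  simpa using h (y - x) (sub_nonneg.2 hxy)

theorem abs_apply_le (h : IsPosFunctional p) (x : X) : |p x| ≤ p |x| :=
  abs_le'.2 ⟨h.mono (le_abs_self x), by simpa using h.mono (neg_le_abs x)⟩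

/-- This makes the pieces of a split functional an admissible family for the free norm, up to
scaling. -/
theorem list_sum_abs_apply_le {l : List (StrongDual ℝ X)} (hl : ∀ q ∈ l, IsPosFunctional q)
    (x : X) : (l.map fun q => |q x|).sum ≤ l.sum |x| := by
  induction l with
  | nil => simp
  | cons q l ih =>
    simp only [List.map_cons, List.sum_cons, _root_.add_apply]
    exact add_le_add ((hl q (by simp)).abs_apply_le x) (ih fun q hq => hl q (by simp [hq]))

end IsPosFunctional

theorem norm_posPart_le {X : Type*} [NormedAddCommGroup X] [Lattice X] [IsOrderedAddMonoid X]
    [HasSolidNorm X] (x : X) : ‖x⁺‖ ≤ ‖x‖ :=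
  norm_le_norm_of_abs_le_abs (by
    rw [abs_of_nonneg (posPart_nonneg x)]
    exact sup_le (le_abs_self x) (abs_nonneg x))

variable [IsOrderedAddMonoid X] [HasSolidNorm X]

/-- A linear functional that is bounded above by `c * ‖x⁺‖` is bounded and positive. -/
theorem exists_isPosFunctional_of_le {g : X →ₗ[ℝ] ℝ} {c : ℝ} (hc : 0 ≤ c)
    (hg : ∀ x, g x ≤ c * ‖x⁺‖) :
    ∃ p : StrongDual ℝ X, IsPosFunctional p ∧ ‖p‖ ≤ c ∧ ∀ x, p x = g x := by
  have hle (x : X) : g x ≤ c * ‖x‖ :=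
    (hg x).trans (mul_le_mul_of_nonneg_left (norm_posPart_le x) hc)
  refine ⟨g.mkContinuous c fun x => abs_le'.2 ⟨hle x, by simpa using hle (-x)⟩, fun x hx => ?_,
    LinearMap.mkContinuous_norm_le _ hc _, fun x => rfl⟩
  -- For `x ≥ 0` the positive part of `-x` vanishes, so the bound becomes `g (-x) ≤ 0`.
  have h := hg (-x)
  rw [posPart_eq_zero.2 (neg_nonpos.2 hx)] at h
  simpa using h

variable [IsOrderedModule ℝ X]

/-- Hahn–Banach is applied to `y ↦ ‖y⁺‖` rather than to the norm, since domination by it also forces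
positivity. -/
theorem exists_isPosFunctional_apply_abs_eq_norm (x : X) :
    ∃ p : StrongDual ℝ X, IsPosFunctional p ∧ ‖p‖ ≤ 1 ∧ p |x| = ‖x‖ := by
  obtain ⟨g, hgx, hg⟩ := exists_linear_le_sublinear_eq (fun y : X => ‖y⁺‖)
    (fun c hc y => by rw [posPart_smul_of_pos hc, norm_smul, Real.norm_of_nonneg hc.le])
    (fun y z => (norm_le_norm_of_abs_le_abs (by
      rw [abs_of_nonneg (posPart_nonneg _), abs_of_nonneg (by positivity)]
      exact posPart_add_le_add y z)).trans (norm_add_le _ _))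
    (fun y => norm_nonneg _) |x|
  obtain ⟨p, hp, hp1, hpg⟩ := exists_isPosFunctional_of_le zero_le_one (by simpa using hg)
  refine ⟨p, hp, hp1, ?_⟩
  rw [hpg, hgx, posPart_of_nonneg (abs_nonneg x), norm_abs_eq_norm]

/-- A positive functional splits along a vector `w` into a part that vanishes at `w⁻` and one that
vanishes at `w⁺`. -/
theorem IsPosFunctional.exists_split {p : StrongDual ℝ X} (hp : IsPosFunctional p) (w : X) :
    ∃ p₁ p₂ : StrongDual ℝ X, IsPosFunctional p₁ ∧ IsPosFunctional p₂ ∧ p₁ + p₂ = p ∧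
      p₁ w⁻ = 0 ∧ p₂ w⁺ = 0 := by
  -- A functional below `y ↦ p y⁺` lies between `0` and `p` on the positive cone; it is chosen to
  -- attain the bound at `w`.
  obtain ⟨g, hgw, hg⟩ := exists_linear_le_sublinear_eq (fun y : X => p y⁺)
    (fun c hc y => by rw [posPart_smul_of_pos hc, map_smul, smul_eq_mul])
    (fun y z => by rw [← map_add]; exact hp.mono (posPart_add_le_add y z))
    (fun y => hp _ (posPart_nonneg y)) w
  obtain ⟨p₁, hp₁, -, hpg⟩ := exists_isPosFunctional_of_le (norm_nonneg p) fun x =>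
    (hg x).trans ((le_abs_self _).trans (p.le_opNorm _))
  have hle (x : X) (hx : 0 ≤ x) : p₁ x ≤ p x := by
    rw [hpg]
    simpa [posPart_of_nonneg hx] using hg x
  -- Since `p₁ w⁺ ≤ p w⁺` and `p₁ w⁻ ≥ 0`, both inequalities must be equalities.
  have h1 : p₁ w⁺ - p₁ w⁻ = p w⁺ := by rw [← map_sub, posPart_sub_negPart, hpg, hgw]
  have h2 := hle _ (posPart_nonneg w)
  have h3 := hp₁ _ (negPart_nonneg w)
  refine ⟨p₁, p - p₁, hp₁, fun x hx => by simpa using hle x hx, by simp, by linarith, ?_⟩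
  rw [_root_.sub_apply]
  linarith

end PositiveFunctionals

/-- Suprema and infima are linear expressions in `x`, `y` and `|x - y|`. -/
theorem IsLatticeHom.of_map_abs {X Y : Type*} [NormedAddCommGroup X] [NormedSpace ℝ X]
    [Lattice X] [IsOrderedAddMonoid X] [NormedAddCommGroup Y] [NormedSpace ℝ Y] [Lattice Y]
    [IsOrderedAddMonoid Y] {T : X →L[ℝ] Y} (h : ∀ x, T |x| = |T x|) :
    IsLatticeHom T where
  map_sup x y := by
    simp only [sup_eq_half_smul_add_add_abs_sub' ℝ, map_smul, map_add, h, map_sub]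
  map_inf x y := by
    simp only [inf_eq_half_smul_add_sub_abs_sub' ℝ, map_smul, map_add, h, map_sub]
  map_abs := h

/-! ### The free Banach lattice -/

/-! ### Exact functionals and exact pairs. -/

section Exactness

variable {E X : Type*} [NormedAddCommGroup E] [NormedSpace ℝ E] [NormedAddCommGroup X]
  [NormedSpace ℝ X] [Lattice X]

/-- The family is rescaled by `c⁻¹`, and `f` is positively homogeneous. Lists allow repetitions and
match the sums supplied by `AddSubmonoid.closure`. -/
theorem FBLAmbient.list_sum_le (f : FBLAmbient E) {c : ℝ} (hc : 0 < c)
    (l : List (StrongDual ℝ E)) (hl : ∀ x, (l.map fun φ => |φ x|).sum ≤ c * ‖x‖) :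
    (l.map fun φ => |f φ|).sum ≤ c * ‖f‖ := by
  have h := f.sum_le_norm (fun k : Fin l.length => c⁻¹ • l.get k) fun x => by
    have h1 : ∑ k : Fin l.length, |(c⁻¹ • l.get k) x| = c⁻¹ * (l.map fun φ => |φ x|).sum := by
      simp only [_root_.smul_apply, smul_eq_mul, abs_mul, abs_inv, abs_of_pos hc,
        ← Finset.mul_sum, List.get_eq_getElem]
      rw [Fin.sum_univ_fun_getElem l fun φ => |φ x|]
    rw [h1, inv_mul_le_iff₀ hc]
    exact hl x
  simp only [f.homog (inv_nonneg.2 hc.le), abs_mul, abs_inv, abs_of_pos hc, ← Finset.mul_sum,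
    List.get_eq_getElem] at h
  rwa [Fin.sum_univ_fun_getElem l fun φ => |f φ|, inv_mul_le_iff₀ hc] at h

/-- The positive functionals `p` such that `p' u = f (p' ∘ T)` for all `0 ≤ p' ≤ p`, where
`q = (f, u)`. -/
def exactFunctionals (T : E →L[ℝ] X) (q : FBLAmbient E × X) : Set (StrongDual ℝ X) :=
  {p | IsPosFunctional p ∧
    ∀ p', IsPosFunctional p' → IsPosFunctional (p - p') → p' q.2 = q.1 (p' ∘L T)}

/-- Exactness is required of all smaller functionals precisely so that it survives further
splitting. -/
theorem mem_exactFunctionals_of_le {T : E →L[ℝ] X} {q : FBLAmbient E × X} {p p' : StrongDual ℝ X}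
    (hp : p ∈ exactFunctionals T q) (hp' : IsPosFunctional p') (h : IsPosFunctional (p - p')) :
    p' ∈ exactFunctionals T q :=
  ⟨hp', fun p'' h1 h2 => hp.2 p'' h1 (by simpa using h2.add h)⟩

theorem isPosFunctional_of_mem_closure {T : E →L[ℝ] X} {q : FBLAmbient E × X} {p : StrongDual ℝ X}
    (hp : p ∈ AddSubmonoid.closure (exactFunctionals T q)) : IsPosFunctional p := by
  induction hp using AddSubmonoid.closure_induction with
  | mem p hp => exact hp.1
  | zero => exact .zero
  | add p p' _ _ h h' => exact h.add h'

/-- Each summand of a decomposition of `p` into positive functionals lies below `p`, so it inherits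
exactness for `q`. -/
theorem mem_closure_inter_of_mem {T : E →L[ℝ] X} {q r : FBLAmbient E × X} {p : StrongDual ℝ X}
    (hp : p ∈ exactFunctionals T q) (hp' : p ∈ AddSubmonoid.closure (exactFunctionals T r)) :
    p ∈ AddSubmonoid.closure (exactFunctionals T q ∩ exactFunctionals T r) := by
  induction hp' using AddSubmonoid.closure_induction with
  | mem p h => exact AddSubmonoid.subset_closure ⟨hp, h⟩
  | zero => exact zero_mem _
  | add p p' hp₁ hp₂ ih ih' =>
    have h := isPosFunctional_of_mem_closure hp₁
    have h' := isPosFunctional_of_mem_closure hp₂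
    exact add_mem (ih (mem_exactFunctionals_of_le hp h (by simpa using h')))
      (ih' (mem_exactFunctionals_of_le hp h' (by simpa using h)))

/-- Every positive functional is a sum of functionals that are exact for the pair `q`. -/
def IsExactPair (T : E →L[ℝ] X) (q : FBLAmbient E × X) : Prop :=
  ∀ p, IsPosFunctional p → p ∈ AddSubmonoid.closure (exactFunctionals T q)

variable {T : E →L[ℝ] X} {q r s : FBLAmbient E × X}

/-- Common refinement: split for `q`, then split every piece for `r`. -/
theorem IsExactPair.mem_closure_inter (hq : IsExactPair T q) (hr : IsExactPair T r)
    {p : StrongDual ℝ X} (hp : IsPosFunctional p) :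
    p ∈ AddSubmonoid.closure (exactFunctionals T q ∩ exactFunctionals T r) := by
  have h := hq p hp
  induction h using AddSubmonoid.closure_induction with
  | mem p h => exact mem_closure_inter_of_mem h (hr p hp)
  | zero => exact zero_mem _
  | add p p' hp₁ hp₂ ih ih' =>
    exact add_mem (ih (isPosFunctional_of_mem_closure hp₁))
      (ih' (isPosFunctional_of_mem_closure hp₂))

theorem IsExactPair.of_inter (hq : IsExactPair T q) (hr : IsExactPair T r)
    (h : exactFunctionals T q ∩ exactFunctionals T r ⊆
      AddSubmonoid.closure (exactFunctionals T s)) : IsExactPair T s := fun _ hp =>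
  AddSubmonoid.closure_le.2 h (hq.mem_closure_inter hr hp)

variable (T) in
theorem isExactPair_eval (x : E) : IsExactPair T (FBLAmbient.eval E x, T x) := fun _ hp =>
  AddSubmonoid.subset_closure ⟨hp, fun _ _ _ => rfl⟩

theorem IsExactPair.add (hq : IsExactPair T q) (hr : IsExactPair T r) : IsExactPair T (q + r) :=
  hq.of_inter hr fun _ ⟨h1, h2⟩ => AddSubmonoid.subset_closure ⟨h1.1, fun p' hp' hp => by
    rw [Prod.snd_add, Prod.fst_add, map_add, FBLAmbient.add_apply, h1.2 p' hp' hp,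
      h2.2 p' hp' hp]⟩

theorem IsExactPair.smul (c : ℝ) (hq : IsExactPair T q) : IsExactPair T (c • q) :=
  hq.of_inter hq fun _ ⟨h, _⟩ => AddSubmonoid.subset_closure ⟨h.1, fun p' hp' hp => by
    rw [Prod.smul_snd, Prod.smul_fst, map_smul, FBLAmbient.smul_apply, h.2 p' hp' hp, smul_eq_mul]⟩

variable (T) in
/-- The vector sublattice of the pairs `(f, u)` such that every positive functional is a sum of
functionals that are exact for `(f, u)`. -/
def exactPairs : Submodule ℝ (FBLAmbient E × X) where
  carrier := {q | IsExactPair T q}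
  zero_mem' := by
    have := isExactPair_eval T 0
    rwa [map_zero, map_zero] at this
  add_mem' := IsExactPair.add
  smul_mem' c _ := IsExactPair.smul c

variable (T) in
/-- The closure of the vector sublattice of exact pairs; over the free Banach lattice it is the
graph of the lattice homomorphism that extends `T`. -/
noncomputable def extensionGraph : Submodule ℝ (FBLAmbient E × X) := (exactPairs T).topologicalClosure

theorem eval_mem_extensionGraph (x : E) : (FBLAmbient.eval E x, T x) ∈ extensionGraph T :=
  (exactPairs T).le_topologicalClosure (isExactPair_eval T x)

/-! ### Lattice operations on exact pairs and the norm estimate. -/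

section Sup

variable [IsOrderedAddMonoid X]

/-- Such a `p`, and everything below it, takes the same value at `q.2 ⊔ r.2 = q.2 + (r.2 - q.2)⁺` as
at `q.2`. Exactness carries the comparison `p' r.2 ≤ p' q.2` over to the functions at `p' ∘ T`,
where `q.1` is therefore the larger. -/
theorem mem_exactFunctionals_sup {p : StrongDual ℝ X} (hq : p ∈ exactFunctionals T q)
    (hr : p ∈ exactFunctionals T r) (h : p (r.2 - q.2)⁺ = 0) :
    p ∈ exactFunctionals T (q ⊔ r) := by
  refine ⟨hq.1, fun p' hp' hp => ?_⟩
  have h0 : p' (r.2 - q.2)⁺ = 0 := by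
    refine le_antisymm ?_ (hp' _ (posPart_nonneg _))
    simpa [h] using hp _ (posPart_nonneg (r.2 - q.2))
  have h1 : p' (q.2 ⊔ r.2) = p' q.2 := by
    rw [sup_comm, sup_eq_add_posPart_sub, map_add, h0, add_zero]
  have h2 : p' r.2 ≤ p' q.2 := h1 ▸ hp'.mono le_sup_right
  rw [hq.2 p' hp' hp, hr.2 p' hp' hp] at h2
  rw [Prod.snd_sup, Prod.fst_sup, h1, FBLAmbient.sup_apply, sup_eq_left.2 h2, hq.2 p' hp' hp]

variable [IsOrderedModule ℝ X] [HasSolidNorm X]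

theorem IsExactPair.sup (hq : IsExactPair T q) (hr : IsExactPair T r) : IsExactPair T (q ⊔ r) := by
  refine hq.of_inter hr ?_
  rintro p ⟨h1, h2⟩
  -- On `p₁` the supremum is given by `q`, on `p₂` by `r`.
  obtain ⟨p₁, p₂, hp₁, hp₂, rfl, h₁, h₂⟩ := h1.1.exists_split (q.2 - r.2)
  have h3 := mem_exactFunctionals_of_le h1 hp₁ (by simpa using hp₂)
  have h4 := mem_exactFunctionals_of_le h2 hp₁ (by simpa using hp₂)
  have h5 := mem_exactFunctionals_of_le h1 hp₂ (by simpa using hp₁)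
  have h6 := mem_exactFunctionals_of_le h2 hp₂ (by simpa using hp₁)
  refine add_mem (AddSubmonoid.subset_closure (mem_exactFunctionals_sup h3 h4 ?_)) ?_
  · rwa [← neg_sub, posPart_neg]
  · rw [sup_comm]
    exact AddSubmonoid.subset_closure (mem_exactFunctionals_sup h6 h5 h₂)

theorem IsExactPair.norm_le (hq : IsExactPair T q) : ‖q.2‖ ≤ ‖T‖ * ‖q.1‖ := by
  have habs : IsExactPair T |q| := hq.sup ((exactPairs T).neg_mem hq)
  obtain ⟨p, hp, hp1, hpq⟩ := exists_isPosFunctional_apply_abs_eq_norm q.2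
  obtain ⟨l, hl, rfl⟩ := AddSubmonoid.exists_list_of_mem_closure (habs p hp)
  have hval : ‖q.2‖ = ((l.map fun p => p ∘L T).map fun φ => |q.1 φ|).sum := by
    have key : ∀ l : List (StrongDual ℝ X), (∀ p ∈ l, p ∈ exactFunctionals T |q|) →
        l.sum |q.2| = ((l.map fun p => p ∘L T).map fun φ => |q.1 φ|).sum := fun l hl => by
      induction l with
      | nil => simp
      | cons p l ih =>
        have hpl := hl p (by simp)
        have : p |q.2| = |q.1 (p ∘L T)| := hpl.2 p hpl.1 (by simpa using .zero)
        simp only [List.map_cons, List.sum_cons, _root_.add_apply, this,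
          ih fun p hp => hl p (by simp [hp])]
    rw [← hpq, key l hl]
  have hbound : ∀ x, ((l.map fun p => p ∘L T).map fun φ => |φ x|).sum ≤ ‖T‖ * ‖x‖ := fun x => by
    have h1 := IsPosFunctional.list_sum_abs_apply_le (fun p h => (hl p h).1) (T x)
    have h2 := (le_abs_self _).trans (l.sum.le_opNorm |T x|)
    rw [norm_abs_eq_norm] at h2
    rw [List.map_map]
    calc _ ≤ _ := h1
      _ ≤ _ := h2
      _ ≤ 1 * ‖T x‖ := by gcongr
      _ ≤ _ := by rw [one_mul]; exact T.le_opNorm x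
  -- Rescaling needs a positive constant and `T` may be zero; so `c > ‖T‖` is used, and then `c`
  -- decreases to `‖T‖`.
  have hc : ∀ c, ‖T‖ < c → ‖q.2‖ ≤ c * ‖q.1‖ := fun c hc => by
    rw [hval]
    exact q.1.list_sum_le ((norm_nonneg T).trans_lt hc) _ fun x =>
      (hbound x).trans (by gcongr)
  exact ge_of_tendsto (x := nhdsWithin ‖T‖ (Set.Ioi ‖T‖)) (f := fun c : ℝ => c * ‖q.1‖)
    (((continuous_id.mul continuous_const).tendsto _).mono_left nhdsWithin_le_nhds)
    (Filter.eventually_of_mem self_mem_nhdsWithin fun c h => hc c h)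

theorem sup_mem_extensionGraph (hq : q ∈ extensionGraph T) (hr : r ∈ extensionGraph T) :
    q ⊔ r ∈ extensionGraph T :=
  map_mem_closure₂ (Continuous.prodMk
    ((continuous_fst.comp continuous_fst).sup (continuous_fst.comp continuous_snd))
    ((continuous_snd.comp continuous_fst).sup (continuous_snd.comp continuous_snd))) hq hr
    fun _ h _ h' => IsExactPair.sup h h'

theorem inf_mem_extensionGraph (hq : q ∈ extensionGraph T) (hr : r ∈ extensionGraph T) :
    q ⊓ r ∈ extensionGraph T := by
  rw [← neg_neg (q ⊓ r), neg_inf]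
  exact neg_mem (sup_mem_extensionGraph (neg_mem hq) (neg_mem hr))

theorem norm_snd_le_of_mem_extensionGraph (hq : q ∈ extensionGraph T) :
    ‖q.2‖ ≤ ‖T‖ * ‖q.1‖ :=
  closure_minimal (s := {q | IsExactPair T q}) (t := {q | ‖q.2‖ ≤ ‖T‖ * ‖q.1‖})
    (fun _ h => IsExactPair.norm_le h) (isClosed_le (by fun_prop) (by fun_prop)) hq

/-- The norm bound applied to `(0, u - v)`. Every algebraic property of the extension follows from
this uniqueness. -/
theorem snd_eq_of_mem_extensionGraph {f : FBLAmbient E} {u v : X} (hu : (f, u) ∈ extensionGraph T)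
    (hv : (f, v) ∈ extensionGraph T) : u = v := by
  have h := norm_snd_le_of_mem_extensionGraph (sub_mem hu hv)
  simpa [sub_eq_zero] using h

/-- By the norm bound, projection of the graph to the first coordinate is bounded below, and the
graph is complete; so the image is closed. It is a sublattice containing the evaluations, hence
contains all that they generate. -/
theorem exists_mem_extensionGraph [CompleteSpace X] (T : E →L[ℝ] X) {f : FBLAmbient E}
    (hf : f ∈ closedSublatticeSpan (Set.range (FBLAmbient.eval E))) :
    ∃ u, (f, u) ∈ extensionGraph T := by
  let π := ContinuousLinearMap.fst ℝ (FBLAmbient E) X ∘L (extensionGraph T).subtypeL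
  have hclosed : IsClosed
      (LinearMap.range (π : extensionGraph T →ₗ[ℝ] FBLAmbient E) : Set (FBLAmbient E)) := by
    have : CompleteSpace (extensionGraph T) :=
      (exactPairs T).isClosed_topologicalClosure.completeSpace_coe
    have hanti : AntilipschitzWith (max 1 ‖T‖₊) π := π.antilipschitz_of_bound fun q => by
      have h := norm_snd_le_of_mem_extensionGraph q.2
      refine max_le ?_ ?_
      · exact le_mul_of_one_le_left (norm_nonneg _) (le_max_left _ _)
      · exact h.trans (mul_le_mul_of_nonneg_right (le_max_right _ _) (norm_nonneg _))
    exact hanti.isClosed_range π.uniformContinuous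
  have hmem : ∀ g, g ∈ LinearMap.range (π : extensionGraph T →ₗ[ℝ] FBLAmbient E) ↔
      ∃ u, (g, u) ∈ extensionGraph T := fun g =>
    ⟨by rintro ⟨⟨⟨g, u⟩, h⟩, rfl⟩; exact ⟨u, h⟩, fun ⟨u, h⟩ => ⟨⟨(g, u), h⟩, rfl⟩⟩
  rw [closedSublatticeSpan, Submodule.mem_sInf] at hf
  refine (hmem f).1 (hf _ ⟨?_, ?_, hclosed, ?_⟩)
  · intro g hg g' hg'
    rw [hmem] at *
    exact ⟨_, sup_mem_extensionGraph hg.choose_spec hg'.choose_spec⟩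
  · intro g hg g' hg'
    rw [hmem] at *
    exact ⟨_, inf_mem_extensionGraph hg.choose_spec hg'.choose_spec⟩
  · rintro _ ⟨x, rfl⟩
    exact (hmem _).2 ⟨_, eval_mem_extensionGraph x⟩

end Sup

end Exactness

/-! ### Existence and uniqueness of extensions to the free Banach lattice. -/

section UniversalProperty

variable {E X : Type*} [NormedAddCommGroup E] [NormedSpace ℝ E] [NormedAddCommGroup X]
  [NormedSpace ℝ X] [Lattice X]

theorem FBL.exists_extension [CompleteSpace X] [IsOrderedAddMonoid X] [IsOrderedModule ℝ X]
    [HasSolidNorm X] (T : E →L[ℝ] X) :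
    ∃ U : FBL E →L[ℝ] X, IsLatticeHom U ∧
      U ∘L (FBL.delta E).toContinuousLinearMap = T ∧ ‖U‖ = ‖T‖ := by
  choose u hu using fun f : FBL E => exists_mem_extensionGraph T f.2
  let U : FBL E →ₗ[ℝ] X :=
    { toFun := u
      map_add' := fun f g =>
        snd_eq_of_mem_extensionGraph (hu (f + g)) (add_mem (hu f) (hu g))
      map_smul' := fun c f =>
        snd_eq_of_mem_extensionGraph (hu (c • f)) (Submodule.smul_mem _ c (hu f)) }
  let V : FBL E →L[ℝ] X := U.mkContinuous ‖T‖ fun f => norm_snd_le_of_mem_extensionGraph (hu f)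
  have hV : V ∘L (FBL.delta E).toContinuousLinearMap = T := by
    ext x
    exact snd_eq_of_mem_extensionGraph (hu (FBL.delta E x)) (eval_mem_extensionGraph x)
  refine ⟨V, .of_map_abs fun f => ?_, hV,
    le_antisymm (U.mkContinuous_norm_le (norm_nonneg T) _) ?_⟩
  · exact snd_eq_of_mem_extensionGraph (hu |f|)
      (sup_mem_extensionGraph (hu f) (neg_mem (hu f)))
  -- The reverse bound uses that `δ` is isometric.
  · refine T.opNorm_le_bound (norm_nonneg V) fun x => ?_
    rw [← hV]
    simpa using V.le_opNorm (FBL.delta E x)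

/-- The equalizer is a closed sublattice containing the generators. It is moved into the ambient
function lattice, where minimality of the generated sublattice is formulated. -/
theorem FBL.hom_ext {U V : FBL E →L[ℝ] X} (hU : IsLatticeHom U) (hV : IsLatticeHom V)
    (h : U ∘L (FBL.delta E).toContinuousLinearMap = V ∘L (FBL.delta E).toContinuousLinearMap) :
    U = V := by
  let S : Submodule ℝ (FBL E) := LinearMap.eqLocus U.toLinearMap V.toLinearMap
  have hS : ∀ f : FBL E, f ∈ S ↔ U f = V f := fun f => Iff.rfl
  let ι : FBL E →ₗ[ℝ] FBLAmbient E :=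
    (closedSublatticeSpan (Set.range (FBLAmbient.eval E))).subtype
  have hmem : ∀ f : FBL E, f.toAmbient ∈ S.map ι ↔ U f = V f := fun f =>
    ⟨by rintro ⟨g, hg, hgf⟩; obtain rfl := Subtype.ext hgf; exact hg, fun h => ⟨f, h, rfl⟩⟩
  ext f
  refine (hmem f).1 ?_
  have hf : f.toAmbient ∈ closedSublatticeSpan (Set.range (FBLAmbient.eval E)) := f.2
  rw [closedSublatticeSpan, Submodule.mem_sInf] at hf
  refine hf _ ⟨?_, ?_, ?_, ?_⟩
  · rintro _ ⟨a, ha, rfl⟩ _ ⟨b, hb, rfl⟩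
    refine (hmem (a ⊔ b)).2 ?_
    rw [hU.map_sup, hV.map_sup, (hS a).1 ha, (hS b).1 hb]
  · rintro _ ⟨a, ha, rfl⟩ _ ⟨b, hb, rfl⟩
    refine (hmem (a ⊓ b)).2 ?_
    rw [hU.map_inf, hV.map_inf, (hS a).1 ha, (hS b).1 hb]
  · have hcl : IsClosed (S : Set (FBL E)) := isClosed_eq U.continuous V.continuous
    have hι := isClosed_closedSublatticeSpan (s := Set.range (FBLAmbient.eval E))
    -- The image stays closed because `FBL E` is closed in the ambient lattice.
    exact hι.isClosedEmbedding_subtypeVal.isClosedMap _ hcl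
  · rintro _ ⟨x, rfl⟩
    exact (hmem (FBL.delta E x)).2 (DFunLike.congr_fun h x)

theorem FBL.isFreeBanachLattice (E : Type*) [NormedAddCommGroup E] [NormedSpace ℝ E]
    [CompleteSpace E] : IsFreeBanachLattice.{w} (FBL.delta E) := by
  intro X _ _ _ _ _ _ _ T
  obtain ⟨U, hU, hUT, hnorm⟩ := FBL.exists_extension T
  exact ⟨U, hU, hUT, hnorm, fun V hV hVT => FBL.hom_ext hV hU (hVT.trans hUT.symm)⟩

end UniversalProperty

/-! ### Push-outs -/

section PushOutProperty

/-- The kernel of a lattice homomorphism is a closed ideal. -/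
def IsLatticeHom.ker {F B : Type*} [NormedAddCommGroup F] [NormedSpace ℝ F] [Lattice F]
    [NormedAddCommGroup B] [NormedSpace ℝ B] [Lattice B] [IsOrderedAddMonoid B]
    {U : F →L[ℝ] B} (hU : IsLatticeHom U) : ClosedIdeal F where
  toSubmodule := LinearMap.ker (U : F →ₗ[ℝ] B)
  isSolid x hx y hxy := by
    have hx' : U x = 0 := hx
    have h : U |y| ⊔ U |x| = U |x| := by rw [← hU.map_sup, sup_eq_right.2 hxy]
    rw [hU.map_abs, hU.map_abs, hx', abs_zero, sup_eq_right] at h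
    exact le_antisymm ((le_abs_self _).trans h) (neg_nonpos.1 ((neg_le_abs _).trans h))
  isClosed := isClosed_singleton.preimage U.continuous

/-! ### Maps out of quotients by closed ideals. -/

namespace ClosedIdeal

variable {F B : Type*} [NormedAddCommGroup F] [NormedSpace ℝ F] [Lattice F]
  [NormedAddCommGroup B] [NormedSpace ℝ B]

theorem subset_span (s : Set F) : s ⊆ (span s).toSubmodule := fun _ hx =>
  Submodule.mem_iInf _ |>.2 fun I => I.2 hx

theorem span_le {s : Set F} {I : ClosedIdeal F} (h : s ⊆ I.toSubmodule) :
    (span s).toSubmodule ≤ I.toSubmodule :=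
  iInf_le (fun I : {I : ClosedIdeal F // s ⊆ I.toSubmodule} => I.1.toSubmodule) ⟨I, h⟩

theorem hom_ext (I : ClosedIdeal F) {U V : I.Quot →L[ℝ] B} (h : U ∘L I.mkQ = V ∘L I.mkQ) :
    U = V := by
  ext x
  obtain ⟨a, rfl⟩ := I.mk_surjective x
  exact DFunLike.congr_fun h a

theorem exists_lift (I : ClosedIdeal F) {U : F →L[ℝ] B}
    (hU : ∀ a ∈ I.toSubmodule, U a = 0) :
    ∃ V : I.Quot →L[ℝ] B, V ∘L I.mkQ = U ∧ ‖V‖ ≤ ‖U‖ := by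
  let V : I.Quot →L[ℝ] B := I.toSubmodule.liftQL U fun a ha => hU a ha
  have hV : ∀ a, V (I.mkQ a) = U a := fun a => rfl
  refine ⟨V, by ext a; exact hV a, V.opNorm_le_bound (norm_nonneg U) fun x => ?_⟩
  -- The quotient norm need not be attained, so nearly optimal representatives are used and `ε`
  -- tends to `0`.
  have key : ∀ ε > 0, ‖V x‖ ≤ ‖U‖ * (‖x‖ + ε) := fun ε hε => by
    obtain ⟨a, rfl, ha⟩ := I.exists_mk_eq_norm_lt x hε
    rw [hV]
    exact (U.le_opNorm a).trans (by gcongr)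
  have hlim : Filter.Tendsto (fun ε : ℝ => ‖U‖ * (‖x‖ + ε)) (nhdsWithin 0 (Set.Ioi 0))
      (nhds (‖U‖ * (‖x‖ + 0))) :=
    (Continuous.tendsto (by fun_prop) _).mono_left nhdsWithin_le_nhds
  rw [add_zero] at hlim
  exact ge_of_tendsto hlim (Filter.eventually_of_mem self_mem_nhdsWithin key)

variable [IsOrderedAddMonoid F] [Lattice B]

theorem isLatticeHom_mkQ (I : ClosedIdeal F) : IsLatticeHom I.mkQ :=
  ⟨I.mk_sup, I.mk_inf, I.mk_abs⟩

theorem isLatticeHom_of_comp_mkQ [IsOrderedAddMonoid B] (I : ClosedIdeal F) {V : I.Quot →L[ℝ] B}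
    (h : IsLatticeHom (V ∘L I.mkQ)) : IsLatticeHom V :=
  .of_map_abs fun x => by
    obtain ⟨a, rfl⟩ := I.mk_surjective x
    rw [← I.mk_abs]
    exact h.map_abs a

end ClosedIdeal

theorem IsLatticeHom.comp {X Y Z : Type*} [NormedAddCommGroup X] [NormedSpace ℝ X] [Lattice X]
    [NormedAddCommGroup Y] [NormedSpace ℝ Y] [Lattice Y] [NormedAddCommGroup Z] [NormedSpace ℝ Z]
    [Lattice Z] {U : Y →L[ℝ] Z} {V : X →L[ℝ] Y} (hU : IsLatticeHom U) (hV : IsLatticeHom V) :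
    IsLatticeHom (U ∘L V) where
  map_sup x y := by simp only [ContinuousLinearMap.comp_apply, hU.map_sup, hV.map_sup]
  map_inf x y := by simp only [ContinuousLinearMap.comp_apply, hU.map_inf, hV.map_inf]
  map_abs x := by simp only [ContinuousLinearMap.comp_apply, hU.map_abs, hV.map_abs]

/-! ### The `ℓ¹`-sum as a coproduct of Banach spaces. -/

namespace L1Sum

variable {X₁ X₂ B : Type*} [NormedAddCommGroup X₁] [NormedSpace ℝ X₁] [NormedAddCommGroup X₂]
  [NormedSpace ℝ X₂] [NormedAddCommGroup B] [NormedSpace ℝ B]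

theorem norm_eq {X₁ X₂ : Type*} [NormedAddCommGroup X₁] [NormedAddCommGroup X₂]
    (x : L1Sum X₁ X₂) : ‖x‖ = ‖x.fst‖ + ‖x.snd‖ := by
  simpa using WithLp.prod_norm_eq_add (p := 1) (by simp) x

theorem norm_inl (x : X₁) : ‖inl X₁ X₂ x‖ = ‖x‖ := by simp [inl]

theorem norm_inr (y : X₂) : ‖inr X₁ X₂ y‖ = ‖y‖ := by simp [inr]

theorem inl_add_inr (x : L1Sum X₁ X₂) : inl X₁ X₂ x.fst + inr X₁ X₂ x.snd = x := by
  apply (WithLp.equiv 1 (X₁ × X₂)).injective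
  ext <;> simp [inl, inr]

theorem hom_ext {U V : L1Sum X₁ X₂ →L[ℝ] B} (h₁ : U ∘L inl X₁ X₂ = V ∘L inl X₁ X₂)
    (h₂ : U ∘L inr X₁ X₂ = V ∘L inr X₁ X₂) : U = V := by
  ext x
  rw [← inl_add_inr x, map_add, map_add]
  exact congrArg₂ _ (DFunLike.congr_fun h₁ _) (DFunLike.congr_fun h₂ _)

/-- The additive norm is what yields the maximum, rather than the sum, of the two operator norms. -/
theorem exists_desc (U₁ : X₁ →L[ℝ] B) (U₂ : X₂ →L[ℝ] B) :
    ∃ U : L1Sum X₁ X₂ →L[ℝ] B, U ∘L inl X₁ X₂ = U₁ ∧ U ∘L inr X₁ X₂ = U₂ ∧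
      ‖U‖ ≤ max ‖U₁‖ ‖U₂‖ := by
  let U : L1Sum X₁ X₂ →L[ℝ] B := U₁.coprod U₂ ∘L
    (WithLp.prodContinuousLinearEquiv 1 ℝ X₁ X₂ : L1Sum X₁ X₂ →L[ℝ] X₁ × X₂)
  have hU : ∀ x, U x = U₁ x.fst + U₂ x.snd := fun x => rfl
  refine ⟨U, by ext x; simp [hU, inl], by ext x; simp [hU, inr],
    U.opNorm_le_bound (le_max_of_le_left (norm_nonneg _)) fun x => ?_⟩
  rw [hU, norm_eq, mul_add]
  refine (norm_add_le _ _).trans (add_le_add ?_ ?_)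
  · exact (U₁.le_opNorm _).trans (by gcongr; exact le_max_left _ _)
  · exact (U₂.le_opNorm _).trans (by gcongr; exact le_max_right _ _)

end L1Sum

/-! ### The universal property of the push-out. -/

namespace PushOut

variable {X₀ X₁ X₂ : Type*} [NormedAddCommGroup X₀] [NormedSpace ℝ X₀]
  [NormedAddCommGroup X₁] [NormedSpace ℝ X₁] [NormedAddCommGroup X₂] [NormedSpace ℝ X₂]
  [Lattice X₁] [Lattice X₂] (T₁ : X₀ →L[ℝ] X₁) (T₂ : X₀ →L[ℝ] X₂)

/-- The first family of generators of `Z` measures the failure of `δ ∘ j₁` to preserve moduli; the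
quotient kills it. -/
theorem isLatticeHom_inl [IsOrderedAddMonoid X₁] : IsLatticeHom (inl T₁ T₂) :=
  .of_map_abs fun x => by
    refine Eq.trans ?_ ((pushOutIdeal T₁ T₂).mk_abs (FBL.delta _ (L1Sum.inl X₁ X₂ x)))
    exact (ClosedIdeal.mk_eq_mk _).2 (ClosedIdeal.subset_span _ (Or.inl (Or.inl ⟨x, rfl⟩)))

theorem isLatticeHom_inr [IsOrderedAddMonoid X₂] : IsLatticeHom (inr T₁ T₂) :=
  .of_map_abs fun y => by
    refine Eq.trans ?_ ((pushOutIdeal T₁ T₂).mk_abs (FBL.delta _ (L1Sum.inr X₁ X₂ y)))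
    exact (ClosedIdeal.mk_eq_mk _).2 (ClosedIdeal.subset_span _ (Or.inl (Or.inr ⟨y, rfl⟩)))

theorem inl_comp_eq_inr_comp : inl T₁ T₂ ∘L T₁ = inr T₁ T₂ ∘L T₂ :=
  ContinuousLinearMap.ext fun z => (ClosedIdeal.mk_eq_mk _).2
    (ClosedIdeal.subset_span _ (Or.inr ⟨z, rfl⟩))

theorem norm_inl_le : ‖inl T₁ T₂‖ ≤ 1 :=
  (inl T₁ T₂).opNorm_le_bound zero_le_one fun x => by
    rw [one_mul, ← L1Sum.norm_inl (X₂ := X₂) x, ← (FBL.delta (L1Sum X₁ X₂)).norm_map]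
    exact ClosedIdeal.norm_mk_le _ _

theorem norm_inr_le : ‖inr T₁ T₂‖ ≤ 1 :=
  (inr T₁ T₂).opNorm_le_bound zero_le_one fun y => by
    rw [one_mul, ← L1Sum.norm_inr (X₁ := X₁) y, ← (FBL.delta (L1Sum X₁ X₂)).norm_map]
    exact ClosedIdeal.norm_mk_le _ _

variable {B : Type*} [NormedAddCommGroup B] [NormedSpace ℝ B] [Lattice B]

variable {T₁ T₂} in
theorem hom_ext {U V : PushOut T₁ T₂ →L[ℝ] B} (hU : IsLatticeHom U) (hV : IsLatticeHom V)
    (h₁ : U ∘L inl T₁ T₂ = V ∘L inl T₁ T₂) (h₂ : U ∘L inr T₁ T₂ = V ∘L inr T₁ T₂) : U = V :=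
  ClosedIdeal.hom_ext _ <| FBL.hom_ext (hU.comp (ClosedIdeal.isLatticeHom_mkQ _))
    (hV.comp (ClosedIdeal.isLatticeHom_mkQ _)) <| L1Sum.hom_ext h₁ h₂

theorem exists_desc [CompleteSpace B] [IsOrderedAddMonoid B] [IsOrderedModule ℝ B]
    [HasSolidNorm B] {U₁ : X₁ →L[ℝ] B} {U₂ : X₂ →L[ℝ] B}
    (hU₁ : IsLatticeHom U₁) (hU₂ : IsLatticeHom U₂) (h : U₁ ∘L T₁ = U₂ ∘L T₂) :
    ∃ V : PushOut T₁ T₂ →L[ℝ] B, IsLatticeHom V ∧ V ∘L inl T₁ T₂ = U₁ ∧ V ∘L inr T₁ T₂ = U₂ ∧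
      ‖V‖ ≤ max ‖U₁‖ ‖U₂‖ := by
  obtain ⟨T, hT₁, hT₂, hTnorm⟩ := L1Sum.exists_desc U₁ U₂
  obtain ⟨U, hU, hUT, hUnorm⟩ := FBL.exists_extension T
  have hl : ∀ x, U (FBL.delta _ (L1Sum.inl X₁ X₂ x)) = U₁ x := fun x =>
    (DFunLike.congr_fun hUT _).trans (DFunLike.congr_fun hT₁ x)
  have hr : ∀ y, U (FBL.delta _ (L1Sum.inr X₁ X₂ y)) = U₂ y := fun y =>
    (DFunLike.congr_fun hUT _).trans (DFunLike.congr_fun hT₂ y)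
  -- The kernel of `U` is a closed ideal, so only the three families of generators need checking.
  have hker : (pushOutIdeal T₁ T₂).toSubmodule ≤ hU.ker.toSubmodule := by
    refine ClosedIdeal.span_le ?_
    rintro _ ((⟨x, rfl⟩ | ⟨y, rfl⟩) | ⟨z, rfl⟩)
    · change U _ = 0
      rw [map_sub, hU.map_abs, hl, hl, hU₁.map_abs, sub_self]
    · change U _ = 0
      rw [map_sub, hU.map_abs, hr, hr, hU₂.map_abs, sub_self]
    · change U _ = 0
      rw [map_sub, hl, hr, sub_eq_zero]
      exact DFunLike.congr_fun h z
  obtain ⟨V, hV, hVnorm⟩ := (pushOutIdeal T₁ T₂).exists_lift fun a ha => hker ha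
  refine ⟨V, ClosedIdeal.isLatticeHom_of_comp_mkQ _ (hV ▸ hU), ?_, ?_,
    hVnorm.trans (hUnorm.trans_le hTnorm)⟩
  · ext x
    exact (DFunLike.congr_fun hV _).trans (hl x)
  · ext y
    exact (DFunLike.congr_fun hV _).trans (hr y)

end PushOut

end PushOutProperty

theorem mainTheorem11
    {X₀ : Type u₀} [NormedAddCommGroup X₀] [NormedSpace ℝ X₀] [CompleteSpace X₀] [Lattice X₀]
    [IsOrderedAddMonoid X₀] [IsOrderedModule ℝ X₀] [HasSolidNorm X₀]
    {X₁ : Type u₁} [NormedAddCommGroup X₁] [NormedSpace ℝ X₁] [CompleteSpace X₁] [Lattice X₁]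
    [IsOrderedAddMonoid X₁] [IsOrderedModule ℝ X₁] [HasSolidNorm X₁]
    {X₂ : Type u₂} [NormedAddCommGroup X₂] [NormedSpace ℝ X₂] [CompleteSpace X₂] [Lattice X₂]
    [IsOrderedAddMonoid X₂] [IsOrderedModule ℝ X₂] [HasSolidNorm X₂]
    (T₁ : X₀ →L[ℝ] X₁) (hT₁ : IsLatticeHom T₁) (T₂ : X₀ →L[ℝ] X₂) (hT₂ : IsLatticeHom T₂) :
    IsFreeBanachLattice.{w} (FBL.delta (L1Sum X₁ X₂)) ∧
      IsIsometricPushout.{w} T₁ T₂ (PushOut.inl T₁ T₂) (PushOut.inr T₁ T₂) := by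
  refine ⟨FBL.isFreeBanachLattice _, PushOut.isLatticeHom_inl T₁ T₂, PushOut.isLatticeHom_inr T₁ T₂,
    PushOut.inl_comp_eq_inr_comp T₁ T₂,
    max_le (PushOut.norm_inl_le T₁ T₂) (PushOut.norm_inr_le T₁ T₂), ?_⟩
  intro B _ _ _ _ _ _ _ U₁ U₂ hU₁ hU₂ h
  obtain ⟨V, hV, hV₁, hV₂, hnorm⟩ := PushOut.exists_desc T₁ T₂ hU₁ hU₂ h
  exact ⟨V, hV, hV₁, hV₂, hnorm, fun W hW hW₁ hW₂ =>
    PushOut.hom_ext hW hV (hW₁.trans hV₁.symm) (hW₂.trans hV₂.symm)⟩
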